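/- **Conventions.** Let $\delta$ be an ordinal with $\lambda:=\mathrm{cf}(\delta)>\omega$. A *chain* is a linear order, and $\bar A\subseteq M$ means that $\bar A$ is a finite sequence of subsets of $M$; $\bar A^\wedge B$ is $\bar A$ prolonged by $B$. A *club* of an ordinal $\alpha$ is a closed unbounded subset of $\alpha$, and a set is *stationary* in $\alpha$ if it meets every club of $\alpha$. **Theories $Th^n$.** For a chain $M$, $\bar A\subseteq M$ and a finite sequence $\bar a$ of elements of $M$, let $th^0(M,\bar A,\bar a)$ be the set of atomic formulas ($x_i=x_j$, $x_i<x_j$, $x_i\in X_j$) true in $M$ of $\bar A,\bar a$, and $th^{n+1}(M,\bar A,\bar a)=\{th^n(M,\bar A,\bar a^\wedge b):b\in M\}$. Let $Th^0(M,\bar A)=th^2(M,\bar A)$ and $Th^{n+1}(M,\bar A)=\{Th^n(M,\bar A^\wedge B):B\subseteq M\}$. Two chains with distinguished subsets have the same monadic theory if they have the same $Th^k$ for all $k<\omega$. For $\bar A\subseteq\delta$ and $\beta<\gamma\le\delta$, $(\delta,\bar A)|_{[\beta,\gamma)}$ is the interval $[\beta,\gamma)$ with the traces of the members of $\bar A$.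 **Theories $ATh^n$.** A club $J$ of $\delta$ *witnesses* $ATh(\delta,\bar A)$ if for each $\beta<\delta$ all the chains $(\delta,\bar A)|_{[\beta,\gamma)}$ with $\gamma\in J$, $\gamma>\beta$, $\mathrm{cf}(\gamma)=\omega$ have the same monadic theory. (Such $J$ exists as $\mathrm{cf}(\delta)>\omega$.) For $\beta<\delta$, $ATh^n(\beta,(\delta,\bar A))$ is the common value of $Th^n((\delta,\bar A)|_{[\beta,\gamma)})$ for these $\gamma$; it does not depend on $J$. **Theories $WTh^n$ and $WA^n$.** For $\bar A\subseteq\alpha$ let $th(\beta,\bar A)$ be the set of formulas $x\in X_i$ with $\beta\in A_i$ and $x\notin X_i$ with $\beta\notin A_i$. If $\alpha$ is a successor or $\mathrm{cf}(\alpha)=\omega$, then $WTh^n(\alpha,\bar A)=\emptyset$. Otherwise $WTh^0(\alpha,\bar A)$ is the set of $t$ such that $\{\beta<\alpha:th(\beta,\bar A)=t\}$ is stationary in $\alpha$, and $WTh^{n+1}(\alpha,\bar A)=\{\langle S_1(B),S_2(B)\rangle:B\subseteq\alpha\}$, where $S_1(B)=WTh^n(\alpha,\bar A^\wedge B)$ and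 $S_2(B)$ is the set of pairs $\langle t,s\rangle$ such that $\{\beta<\alpha:WTh^n((\alpha,\bar A^\wedge B)|_\beta)=t,\ th(\beta,\bar A^\wedge B)=s\}$ is stationary in $\alpha$. Let $g^n(\bar A)$ be the sequence of the sets $g^n(\bar A)_s=\{\beta<\delta:ATh^n(\beta,(\delta,\bar A))=s\}$, indexed by the (finitely many) formally possible values $s$ of $Th^n$ for sequences of the length of $\bar A$. Put $$WA^n(\delta,\bar A)=\langle WTh^n(\delta,g^n(\bar A)),\ ATh^n(0,(\delta,\bar A))\rangle .$$ **Semi-clubs and shufflings.** A set $a\subseteq\lambda$ is a *semi-club* of $\lambda$ if for every $\alpha<\lambda$ with $\mathrm{cf}(\alpha)>\omega$: if $\alpha\in a$, some club of $\alpha$ is contained in $a$; if $\alpha\notin a$, some club of $\alpha$ is disjoint from $a$. If $J=\{\alpha_i:i<\lambda\}$ is a club of $\delta$ in increasing enumeration, put $$[X,Y]^J_a=\bigcup_{i\in a}\bigl(X\cap[\alpha_i,\alpha_{i+1})\bigr)\cup\bigcup_{i\in\lambda\setminus a}\bigl(Y\cap[\alpha_i,\alpha_{i+1})\bigr)$$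 for $X,Y\subseteq\delta$, and define $[\bar X,\bar Y]^J_a$ coordinatewise for sequences of the same length. **Suitable clubs.** Let $\bar P_0,\bar P_1\subseteq\delta$ have the same length and write $s_l(\beta)=ATh^n(\beta,(\delta,\bar P_l))$. A club $J$ of $\delta$ is *$n$-suitable* for $\bar P_0,\bar P_1$ if, for $l=0,1$: (a) $J$ witnesses $ATh(\delta,\bar P_l)$; (b) $J=\{\alpha_i:i<\lambda\}$ in increasing enumeration, with $\alpha_0=0$ and $\mathrm{cf}(\alpha_{i+1})=\omega$ for all $i<\lambda$; (c) for every $s$, $J\cap g^n(\bar P_l)_s\cap\{\gamma<\delta:\mathrm{cf}(\gamma)=\omega\}$ is stationary in $\delta$ or empty; (d) if $n\ge1$ and $WA^n(\delta,\bar P_0)=WA^n(\delta,\bar P_1)$, then for every $j<\lambda$ with $\mathrm{cf}(\alpha_j)\le\omega$ there are $k_1,k_2<\omega$ (possibly $0$) with $s_l(\alpha_{j+k_1})=s_l(\alpha_j)$ and $s_{1-l}(\alpha_{j+k_2})=s_l(\alpha_j)$. **Theorem 4.5.** Let $\bar P_0,\bar P_1\subseteq\delta$ be finite sequences of the same length,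 let $n\ge1$, and suppose that $WA^n(\delta,\bar P_0)=WA^n(\delta,\bar P_1)$. Let $J$ be an $n$-suitable club of $\delta$ for $\bar P_0,\bar P_1$ and let $a\subseteq\lambda$ be a semi-club of $\lambda$. Then $$ATh^n\bigl(0,(\delta,[\bar P_0,\bar P_1]^J_a)\bigr)=ATh^n\bigl(0,(\delta,\bar P_0)\bigr)=ATh^n\bigl(0,(\delta,\bar P_1)\bigr).$$ -/

import Mathlib

open Cardinal Ordinal

universe u

namespace MonadicShuffling

/-! ### The partial theories `th^n` and `Th^n` of a chain with distinguished subsets -/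

/-- Atomic formulas of the monadic language of order, with set variables `X i` (`i : ι`) and
individual variables `x j` (`j : κ`). -/
inductive AtomicFormula (ι κ : Type) : Type
  | eq (j j' : κ)
  | lt (j j' : κ)
  | mem (j : κ) (i : ι)

/-- Truth of an atomic formula in the chain `M` under the assignment `A`, `a`. -/
def AtomicFormula.Holds {M : Type*} [LT M] {ι κ : Type} (A : ι → Set M) (a : κ → M) :
    AtomicFormula ι κ → Prop
  | .eq j j' => a j = a j'
  | .lt j j' => a j < a j'
  | .mem j i => a j ∈ A i

/-- The sequence `s` prolonged by one more entry `x`; the new entry has index `none`. -/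
def append {ι : Type} {X : Type*} (s : ι → X) (x : X) : Option ι → X :=
  fun o => o.elim x s

/-- The type in which `th^n(M, A, a)` lives: sets of sets of … of atomic formulas. -/
def ElemTheory : ℕ → Type → Type → Type
  | 0, ι, κ => Set (AtomicFormula ι κ)
  | n + 1, ι, κ => Set (ElemTheory n ι (Option κ))

/-- `th^n(M, A, a)`: for `n = 0` the set of true atomic formulas, and
`th^{n+1}(M, A, a) = {th^n(M, A, a ^ b) : b ∈ M}`. -/
def elemTheory {M : Type*} [LT M] {ι : Type} (A : ι → Set M) :
    (n : ℕ) → {κ : Type} → (κ → M) → ElemTheory n ι κ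
  | 0, _, a => {φ : AtomicFormula _ _ | φ.Holds A a}
  | n + 1, _, a => Set.range fun b : M => elemTheory A n (append a b)

/-- The type in which `Th^n(M, A)` lives, for a sequence `A` of subsets indexed by `ι`.
For finite `ι` it is a finite set, and it serves as the set of formally possible `Th^n`'s. -/
def Theory : ℕ → Type → Type
  | 0, ι => ElemTheory 2 ι Empty
  | n + 1, ι => Set (Theory n (Option ι))

/-- `Th^n(M, A)`: `Th^0(M, A) = th^2(M, A)` and `Th^{n+1}(M, A) = {Th^n(M, A ^ B) : B ⊆ M}`. -/
def monTheory {M : Type*} [LT M] :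
    (n : ℕ) → {ι : Type} → (ι → Set M) → Theory n ι
  | 0, _, A => elemTheory A 2 Empty.elim
  | n + 1, _, A => Set.range fun B : Set M => monTheory n (append A B)

instance Theory.instNonempty (n : ℕ) (ι : Type) : Nonempty (Theory n ι) := by
  cases n with
  | zero => exact ⟨(∅ : Set (ElemTheory 1 ι (Option Empty)))⟩
  | succ n => exact ⟨(∅ : Set (Theory n (Option ι)))⟩

/-- `Th^n` of the segment `[β, γ)` of the chain of ordinals, with the traces of the sets `A i`. -/
def segTheory (n : ℕ) {ι : Type} (A : ι → Set Ordinal.{u}) (β γ : Ordinal.{u}) : Theory n ι :=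
  monTheory (M := Set.Ico β γ) n fun i => {x | (x : Ordinal) ∈ A i}

/-! ### Clubs and stationary sets -/

/-- `C` is a closed unbounded subset of the ordinal `α`. -/
def IsClubIn (α : Ordinal.{u}) (C : Set Ordinal.{u}) : Prop :=
  C ⊆ Set.Iio α ∧ IsClub {x : Set.Iio α | (x : Ordinal) ∈ C}

/-- (The trace on `α` of) `S` is a stationary subset of the ordinal `α`. -/
def IsStationaryIn (α : Ordinal.{u}) (S : Set Ordinal.{u}) : Prop :=
  IsStationary {x : Set.Iio α | (x : Ordinal) ∈ S}

/-! ### `ATh^n` -/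

/-- `J` is a club of `δ` such that, for each `β < δ`, all the chains `(δ, A)|[β, γ)` with
`γ ∈ J`, `γ > β`, `cf γ = ω` have the same monadic theory, i.e. the same `Th^k` for all `k`. -/
def Witnesses (δ : Ordinal.{u}) {ι : Type} (A : ι → Set Ordinal.{u}) (J : Set Ordinal.{u}) :
    Prop :=
  IsClubIn δ J ∧ ∀ β < δ, ∀ γ ∈ J, ∀ γ' ∈ J, β < γ → β < γ' → γ.cof = ℵ₀ → γ'.cof = ℵ₀ →
    ∀ k : ℕ, segTheory k A β γ = segTheory k A β γ'

/-- `ATh^n(β, (δ, A))`: the common value of `Th^n((δ, A)|[β, γ))` over all `γ ∈ J` with `γ > β`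
and `cf γ = ω`, where `J` is a witnessing club. When `cf δ > ω` there is such a `J`, and the value
is unique because any two clubs of `δ` have a common element of cofinality `ω` above `β`. -/
noncomputable def ATh (n : ℕ) (β δ : Ordinal.{u}) {ι : Type} (A : ι → Set Ordinal.{u}) :
    Theory n ι :=
  Classical.epsilon fun t => ∃ J, Witnesses δ A J ∧
    ∀ γ ∈ J, β < γ → γ.cof = ℵ₀ → segTheory n A β γ = t

/-! ### `WTh^n`, `g^n` and `WA^n` -/

/-- The formulas `x ∈ X i` and `x ∉ X i`. -/
inductive Literal (ι : Type) : Type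
  | mem (i : ι)
  | notMem (i : ι)

/-- `th(β, A) = {x ∈ X i : β ∈ A i} ∪ {x ∉ X i : β ∉ A i}`. -/
def pointType {ι : Type} (A : ι → Set Ordinal.{u}) (β : Ordinal.{u}) : Set (Literal ι) :=
  {φ | ∃ i, φ = .mem i ∧ β ∈ A i} ∪ {φ | ∃ i, φ = .notMem i ∧ β ∉ A i}

/-- The type in which `WTh^n(α, A)` lives. -/
def WTheory : ℕ → Type → Type
  | 0, ι => Set (Set (Literal ι))
  | n + 1, ι =>
    Set (WTheory n (Option ι) × Set (WTheory n (Option ι) × Set (Literal (Option ι))))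

open scoped Classical in
/-- `WTh^n(α, A)`; only the traces of the sets `A i` on `α` matter, so that the restriction of
`(α, A)` to `β < α` is given by replacing `α` by `β`. It is empty if `α` is a successor or has
cofinality `ω`. Otherwise `WTh^0` lists the types `th(β, A)` occurring stationarily often, and
`WTh^{n+1}(α, A)` is the set of pairs `⟨S₁(B), S₂(B)⟩` for `B ⊆ α`, where
`S₁(B) = WTh^n(α, A ^ B)` and `S₂(B)` is the set of `⟨t, s⟩` for which
`{β < α : WTh^n((α, A ^ B)|β) = t, th(β, A ^ B) = s}` is stationary in `α`. -/
noncomputable def WTh : (n : ℕ) → {ι : Type} → Ordinal.{u} → (ι → Set Ordinal.{u}) → WTheory n ι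
  | 0, ι, α, A =>
    if α ∈ Set.range Order.succ ∨ α.cof = ℵ₀ then (∅ : Set (Set (Literal ι)))
    else {t : Set (Literal ι) | IsStationaryIn α {β | pointType A β = t}}
  | n + 1, ι, α, A =>
    if α ∈ Set.range Order.succ ∨ α.cof = ℵ₀ then
      (∅ : Set (WTheory n (Option ι) × Set (WTheory n (Option ι) × Set (Literal (Option ι)))))
    else {p : WTheory n (Option ι) × Set (WTheory n (Option ι) × Set (Literal (Option ι))) |
      ∃ B : Set Ordinal.{u}, B ⊆ Set.Iio α ∧
        p = (WTh n α (append A B),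
          {q | IsStationaryIn α
            {β | WTh n β (append A B) = q.1 ∧ pointType (append A B) β = q.2}})}

/-- `g^n(A)_s = {β < δ : ATh^n(β, (δ, A)) = s}`. -/
def gPart (n : ℕ) (δ : Ordinal.{u}) {ι : Type} (A : ι → Set Ordinal.{u}) (s : Theory n ι) :
    Set Ordinal.{u} :=
  {β | β < δ ∧ ATh n β δ A = s}

/-- `WA^n(δ, A) = ⟨WTh^n(δ, g^n(A)), ATh^n(0, (δ, A))⟩`. -/
noncomputable def WA (n : ℕ) (δ : Ordinal.{u}) {ι : Type} (A : ι → Set Ordinal.{u}) :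
    WTheory n (Theory n ι) × Theory n ι :=
  (WTh n δ (gPart n δ A), ATh n 0 δ A)

/-! ### Semi-clubs, shufflings and suitable clubs -/

/-- `a ⊆ lam` is a semi-club subset of `lam`. -/
def IsSemiClub (lam : Ordinal.{u}) (a : Set Ordinal.{u}) : Prop :=
  a ⊆ Set.Iio lam ∧ ∀ α < lam, ℵ₀ < α.cof →
    (α ∈ a → ∃ C, IsClubIn α C ∧ C ⊆ a) ∧ (α ∉ a → ∃ C, IsClubIn α C ∧ C ∩ a = ∅)

/-- The shuffling `[X, Y]^J_a`, where `J = {α i : i < lam}` in increasing order. -/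
def shuffle (lam : Ordinal.{u}) (α : Ordinal.{u} → Ordinal.{u}) (a X Y : Set Ordinal.{u}) :
    Set Ordinal.{u} :=
  (⋃ i ∈ a, X ∩ Set.Ico (α i) (α (i + 1))) ∪
    ⋃ i ∈ Set.Iio lam \ a, Y ∩ Set.Ico (α i) (α (i + 1))

/-- For every `α j ∈ J` with `cf (α j) ≤ ω`, the theory `s_P(α j)` occurs as `s_P(α (j + k₁))` and
as `s_Q(α (j + k₂))` for some `k₁, k₂ < ω`. -/
def Recurs (n : ℕ) (δ : Ordinal.{u}) {ι : Type} (P Q : ι → Set Ordinal.{u})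
    (α : Ordinal.{u} → Ordinal.{u}) : Prop :=
  ∀ j < δ.cof.ord, (α j).cof ≤ ℵ₀ → ∃ k₁ k₂ : ℕ,
    ATh n (α (j + k₁)) δ P = ATh n (α j) δ P ∧ ATh n (α (j + k₂)) δ Q = ATh n (α j) δ P

/-- `J`, enumerated increasingly as `{α i : i < cf δ}`, is an `n`-suitable club of `δ` for the
sequences `P₀`, `P₁` of subsets of `δ`. -/
structure IsSuitable (n : ℕ) (δ : Ordinal.{u}) {ι : Type} (P₀ P₁ : ι → Set Ordinal.{u})
    (J : Set Ordinal.{u}) (α : Ordinal.{u} → Ordinal.{u}) : Prop where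
  witnesses₀ : Witnesses δ P₀ J
  witnesses₁ : Witnesses δ P₁ J
  strictMonoOn : StrictMonoOn α (Set.Iio δ.cof.ord)
  image_eq : α '' Set.Iio δ.cof.ord = J
  zero : α 0 = 0
  cof_succ : ∀ i < δ.cof.ord, (α (i + 1)).cof = ℵ₀
  stationary₀ : ∀ s : Theory n ι, IsStationaryIn δ (J ∩ gPart n δ P₀ s ∩ {γ | γ.cof = ℵ₀}) ∨
    J ∩ gPart n δ P₀ s ∩ {γ | γ.cof = ℵ₀} = ∅
  stationary₁ : ∀ s : Theory n ι, IsStationaryIn δ (J ∩ gPart n δ P₁ s ∩ {γ | γ.cof = ℵ₀}) ∨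
    J ∩ gPart n δ P₁ s ∩ {γ | γ.cof = ℵ₀} = ∅
  recurs : 1 ≤ n → WA n δ P₀ = WA n δ P₁ → Recurs n δ P₀ P₁ α ∧ Recurs n δ P₁ P₀ α

end MonadicShuffling

open MonadicShuffling

namespace MonadicShuffling

/-! ### Basic properties of the partial theories -/

/-! Everything rests on composition: the theory of an ordered sum is determined by the theories of
its summands (`monTheory_eq_of_fibres`, by a back-and-forth argument). So pieces of a segment of the
shuffled sequence X may be exchanged for pieces of P₀ or P₁ with the same theory.

Write s_b(i) for the `ATh` of P_b at α_i. The core is `segTheory_of_piecewise`: if i < j and cf(α_j)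
= ω, then X on [α_i, α_j) has theory s_b(i), where b is the choice made at i. The induction on j
uses an absorption principle: if X has theory s_b(i) on [α_i, α_j) and s_b'(j) on [α_j, γ), it has
theory s_b(i) on [α_i, γ). Indeed s_b'(j) recurs as some s_b(j+k), so the two pieces can be copied
inside P_b by cutting [α_i, α_{j+k+1}) at α_{j+k}.

If j is a limit of cofinality ω, one choice b occurs cofinally below j, and an ω-sum shows that X
looks like P_b on a final segment. If j is the successor of an index of uncountable cofinality, the
semi-club gives a club on which the choice agrees with the choice at that index, and summing along
it (`segTheory_eq_of_closed`) compares X with a single P_b. In both cases absorption extends the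
result down to i.

Equality of the `WA` enters through the recurrence in the definition of suitability and through
s_0(0) = s_1(0). To read the core result as a statement about `ATh`, the shuffled sequence needs a
witnessing club of its own; `exists_witnesses` gets one from a Ramsey argument. -/

theorem append_comp_map {κ κ' : Type} {X : Type*} (a : κ → X) (x : X) (f : κ' → κ) :
    append (a ∘ f) x = append a x ∘ Option.map f := by
  funext o
  cases o <;> rfl

theorem range_eq_range_iff {X Y T : Type*} {f : X → T} {g : Y → T} :
    Set.range f = Set.range g ↔ (∀ x, ∃ y, f x = g y) ∧ ∀ y, ∃ x, f x = g y := by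
  constructor
  · intro h
    refine ⟨fun x => ?_, fun y => ?_⟩
    · obtain ⟨y, hy⟩ : f x ∈ Set.range g := h ▸ Set.mem_range_self x
      exact ⟨y, hy.symm⟩
    · have : g y ∈ Set.range f := h.symm ▸ Set.mem_range_self y
      exact this
  · rintro ⟨h₁, h₂⟩
    ext t
    constructor
    · rintro ⟨x, rfl⟩
      obtain ⟨y, hy⟩ := h₁ x
      exact ⟨y, hy.symm⟩
    · rintro ⟨y, rfl⟩
      exact h₂ y

section Chains

variable {M N I : Type*} {ι : Type}

theorem elemTheory_succ_eq_iff [LT M] [LT N] {A : ι → Set M} {B : ι → Set N} {n : ℕ} {κ : Type}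
    {a : κ → M} {b : κ → N} :
    elemTheory A (n + 1) a = elemTheory B (n + 1) b ↔
      (∀ x, ∃ y, elemTheory A n (append a x) = elemTheory B n (append b y)) ∧
        ∀ y, ∃ x, elemTheory A n (append a x) = elemTheory B n (append b y) :=
  range_eq_range_iff

theorem monTheory_succ_eq_iff [LT M] [LT N] {A : ι → Set M} {B : ι → Set N} {n : ℕ} :
    monTheory (n + 1) A = monTheory (n + 1) B ↔
      (∀ S, ∃ T, monTheory n (append A S) = monTheory n (append B T)) ∧
        ∀ T, ∃ S, monTheory n (append A S) = monTheory n (append B T) :=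
  range_eq_range_iff

theorem elemTheory_zero_eq_iff [LT M] [LT N] {A : ι → Set M} {B : ι → Set N} {κ : Type}
    {a : κ → M} {b : κ → N} :
    elemTheory A 0 a = elemTheory B 0 b ↔
      ∀ φ : AtomicFormula ι κ, φ.Holds A a ↔ φ.Holds B b :=
  Set.ext_iff

/-- Substituting variables preserves equality of elementary theories. -/
theorem elemTheory_comp [LT M] [LT N] {A : ι → Set M} {B : ι → Set N} (n : ℕ) :
    ∀ {κ κ' : Type} {a : κ → M} {b : κ → N} (f : κ' → κ),
      elemTheory A n a = elemTheory B n b → elemTheory A n (a ∘ f) = elemTheory B n (b ∘ f) := by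
  induction n with
  | zero =>
    intro κ κ' a b f h
    rw [elemTheory_zero_eq_iff] at h ⊢
    rintro (⟨j, j'⟩ | ⟨j, j'⟩ | ⟨j, i⟩)
    · exact h (.eq (f j) (f j'))
    · exact h (.lt (f j) (f j'))
    · exact h (.mem (f j) i)
  | succ n ih =>
    intro κ κ' a b f h
    rw [elemTheory_succ_eq_iff] at h ⊢
    simp only [append_comp_map]
    exact ⟨fun x => (h.1 x).imp fun y hy => ih _ hy, fun y => (h.2 y).imp fun x hx => ih _ hx⟩

/-- Append any element and forget it again. An empty chain has nothing to append, but then there are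
no individual variables and no moves either. -/
theorem elemTheory_of_succ [LT M] [LT N] {A : ι → Set M} {B : ι → Set N} (n : ℕ) {κ : Type}
    {a : κ → M} {b : κ → N} (h : elemTheory A (n + 1) a = elemTheory B (n + 1) b) :
    elemTheory A n a = elemTheory B n b := by
  rw [elemTheory_succ_eq_iff] at h
  rcases isEmpty_or_nonempty M with hM | ⟨⟨x⟩⟩
  · have hN : IsEmpty N := ⟨fun y => hM.elim (h.2 y).choose⟩
    have hκ : IsEmpty κ := ⟨fun k => hM.elim (a k)⟩
    cases n with
    | zero =>
      rw [elemTheory_zero_eq_iff]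
      rintro (⟨j, j'⟩ | ⟨j, j'⟩ | ⟨j, i⟩) <;> exact hκ.elim j
    | succ n =>
      rw [elemTheory_succ_eq_iff]
      exact ⟨fun x => hM.elim x, fun y => hN.elim y⟩
  · obtain ⟨y, hy⟩ := h.1 x
    exact elemTheory_comp n some hy

theorem elemTheory_equiv [LT M] [LT N] (e : M ≃ N)
    (he : ∀ x y, x < y ↔ e x < e y) {A : ι → Set M} {B : ι → Set N}
    (h : ∀ i x, x ∈ A i ↔ e x ∈ B i) (n : ℕ) :
    ∀ {κ : Type} (a : κ → M), elemTheory A n a = elemTheory B n (e ∘ a) := by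
  induction n with
  | zero =>
    intro κ a
    rw [elemTheory_zero_eq_iff]
    rintro (⟨j, j'⟩ | ⟨j, j'⟩ | ⟨j, i⟩)
    · exact e.injective.eq_iff.symm
    · exact he _ _
    · exact h _ _
  | succ n ih =>
    intro κ a
    have key (x : M) : append (e ∘ a) (e x) = e ∘ append a x := by
      funext o
      cases o <;> rfl
    rw [elemTheory_succ_eq_iff]
    refine ⟨fun x => ⟨e x, ?_⟩, fun y => ⟨e.symm y, ?_⟩⟩
    · rw [key, ih]
    · rw [← e.apply_symm_apply y, key, ih, e.symm_apply_apply]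

/-- Isomorphic chains with distinguished subsets have the same monadic theories. -/
theorem monTheory_orderIso [LinearOrder M] [LinearOrder N] (e : M ≃o N) (n : ℕ) :
    ∀ {ι : Type} {A : ι → Set M} {B : ι → Set N}, (∀ i x, x ∈ A i ↔ e x ∈ B i) →
      monTheory n A = monTheory n B := by
  induction n with
  | zero =>
    intro ι A B h
    have := elemTheory_equiv e.toEquiv (fun x y => e.lt_iff_lt.symm) h 2 Empty.elim
    rwa [show e.toEquiv ∘ Empty.elim = Empty.elim from funext fun k => k.elim] at this
  | succ n ih =>
    intro ι A B h
    rw [monTheory_succ_eq_iff]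
    refine ⟨fun S => ⟨e.symm ⁻¹' S, ih ?_⟩, fun T => ⟨e ⁻¹' T, ih ?_⟩⟩ <;>
    · rintro (_ | i) x
      · simp [append]
      · exact h i x

/-- The traces of the sets `A i` on a fibre of `p`. -/
abbrev fibreTrace (p : M → I) (A : ι → Set M) (i : I) : ι → Set {x // p x = i} :=
  fun j => {x | (x : M) ∈ A j}

theorem fibreTrace_append (p : M → I) (A : ι → Set M) (S : Set M) (i : I) :
    fibreTrace p (append A S) i = append (fibreTrace p A i) {x | (x : M) ∈ S} := by
  funext o
  cases o <;> rfl

variable [LinearOrder M] [LinearOrder N] [LinearOrder I]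

/-- Composition theorem for elementary theories: the theory of an ordered sum, presented by
monotone maps onto the index chain, is determined by the theories of the summands. -/
theorem elemTheory_eq_of_fibres {p : M → I} {q : N → I} (hp : Monotone p) (hq : Monotone q)
    {A : ι → Set M} {B : ι → Set N} (n : ℕ) :
    ∀ {κ : Type} (a : κ → M) (b : κ → N) (hab : ∀ k, p (a k) = q (b k)),
      (∀ i, elemTheory (fibreTrace p A i) n (fun k : {k // p (a k) = i} => ⟨a k, k.2⟩) =
        elemTheory (fibreTrace q B i) n
          (fun k : {k // p (a k) = i} => ⟨b k, (hab k).symm.trans k.2⟩)) →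
      elemTheory A n a = elemTheory B n b := by
  induction n with
  | zero =>
    intro κ a b hab h
    simp only [elemTheory_zero_eq_iff] at h ⊢
    rintro (⟨j, j'⟩ | ⟨j, j'⟩ | ⟨j, i⟩)
    · by_cases hj : p (a j) = p (a j')
      · simpa [AtomicFormula.Holds] using h (p (a j')) (.eq ⟨j, hj⟩ ⟨j', rfl⟩)
      · refine iff_of_false (fun e => hj (congrArg p e)) fun e => hj ?_
        rw [hab, hab]
        exact congrArg q e
    · rcases lt_trichotomy (p (a j)) (p (a j')) with hj | hj | hj
      · refine iff_of_true (hp.reflect_lt hj) (hq.reflect_lt ?_)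
        rwa [← hab, ← hab]
      · simpa [AtomicFormula.Holds] using h (p (a j')) (.lt ⟨j, hj⟩ ⟨j', rfl⟩)
      · refine iff_of_false (hp.reflect_lt hj).asymm (hq.reflect_lt (?_ : _ < _)).asymm
        rwa [← hab, ← hab]
    · simpa [AtomicFormula.Holds] using h (p (a j)) (.mem ⟨j, rfl⟩ i)
  | succ n ih =>
    intro κ a b hab h
    -- One round of back-and-forth: the answer to x is sought in the fibre over the same index. That
    -- fibre uses up its extra quantifier; every other fibre just drops one level.
    have step (i : I) (x : M) (y : N) (hx : p x = i) (hy : q y = i)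
        (hth : elemTheory (fibreTrace p A i) n
            (append (fun k : {k // p (a k) = i} => ⟨a k, k.2⟩) ⟨x, hx⟩) =
          elemTheory (fibreTrace q B i) n
            (append (fun k : {k // p (a k) = i} => ⟨b k, (hab k).symm.trans k.2⟩) ⟨y, hy⟩)) :
        elemTheory A n (append a x) = elemTheory B n (append b y) := by
      subst hx
      refine ih (append a x) (append b y) (by rintro (_ | k); exacts [hy.symm, hab k]) fun i => ?_
      by_cases hi : p x = i
      · subst hi
        let f : {o : Option κ // p (append a x o) = p x} → Option {k // p (a k) = p x} :=
          fun o => match o with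
            | ⟨none, _⟩ => none
            | ⟨some k, hk⟩ => some ⟨k, hk⟩
        convert elemTheory_comp n f hth using 2
        · funext o
          rcases o with ⟨_ | k, hk⟩ <;> rfl
        · funext o
          rcases o with ⟨_ | k, hk⟩ <;> rfl
      · let f : {o : Option κ // p (append a x o) = i} → {k // p (a k) = i} :=
          fun o => match o with
            | ⟨none, hk⟩ => (hi hk).elim
            | ⟨some k, hk⟩ => ⟨k, hk⟩
        convert elemTheory_comp n f (elemTheory_of_succ n (h i)) using 2
        · funext o
          rcases o with ⟨_ | k, hk⟩
          exacts [(hi hk).elim, rfl]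
        · funext o
          rcases o with ⟨_ | k, hk⟩
          exacts [(hi hk).elim, rfl]
    rw [elemTheory_succ_eq_iff]
    constructor
    · intro x
      obtain ⟨⟨y, hy⟩, hxy⟩ := (elemTheory_succ_eq_iff.1 (h (p x))).1 ⟨x, rfl⟩
      exact ⟨y, step _ x y rfl hy hxy⟩
    · intro y
      obtain ⟨⟨x, hx⟩, hxy⟩ := (elemTheory_succ_eq_iff.1 (h (q y))).2 ⟨y, rfl⟩
      exact ⟨x, step _ x y hx rfl hxy⟩

/-- Composition theorem for monadic theories. -/
theorem monTheory_eq_of_fibres {p : M → I} {q : N → I} (hp : Monotone p) (hq : Monotone q)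
    (n : ℕ) :
    ∀ {ι : Type} {A : ι → Set M} {B : ι → Set N},
      (∀ i, monTheory n (fibreTrace p A i) = monTheory n (fibreTrace q B i)) →
      monTheory n A = monTheory n B := by
  induction n with
  | zero =>
    intro ι A B h
    refine elemTheory_eq_of_fibres hp hq 2 _ _ (fun k => k.elim) fun i => ?_
    convert elemTheory_comp 2 (fun k : {k : Empty // p k.elim = i} => k.1) (h i) using 2 <;>
    exact funext fun k => k.1.elim
  | succ n ih =>
    intro ι A B h
    rw [monTheory_succ_eq_iff]
    constructor
    · intro S
      -- The subset is answered separately in each fibre, and the answers are glued.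
      choose T hT using fun i => (monTheory_succ_eq_iff.1 (h i)).1 {x | (x : M) ∈ S}
      refine ⟨{y | (⟨y, rfl⟩ : {y' // q y' = q y}) ∈ T (q y)}, ih fun i => ?_⟩
      rw [fibreTrace_append, fibreTrace_append, hT]
      congr 2
      ext ⟨y, rfl⟩
      rfl
    · intro T
      choose S hS using fun i => (monTheory_succ_eq_iff.1 (h i)).2 {y | (y : N) ∈ T}
      refine ⟨{x | (⟨x, rfl⟩ : {x' // p x' = p x}) ∈ S (p x)}, ih fun i => ?_⟩
      rw [fibreTrace_append, fibreTrace_append, ← hS]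
      congr 2
      ext ⟨x, rfl⟩
      rfl

end Chains

/-! ### Finiteness of the set of formally possible theories -/

section Finite

instance AtomicFormula.instFinite (ι κ : Type) [Finite ι] [Finite κ] :
    Finite (AtomicFormula ι κ) := by
  let f : AtomicFormula ι κ → (κ × κ) ⊕ (κ × κ) ⊕ (κ × ι)
    | .eq j j' => .inl (j, j')
    | .lt j j' => .inr (.inl (j, j'))
    | .mem j i => .inr (.inr (j, i))
  refine Finite.of_injective f ?_
  rintro (⟨j, j'⟩ | ⟨j, j'⟩ | ⟨j, i⟩) (⟨k, k'⟩ | ⟨k, k'⟩ | ⟨k, i'⟩) h <;> simp_all [f]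

theorem ElemTheory.finite (n : ℕ) :
    ∀ (ι κ : Type) [Finite ι] [Finite κ], Finite (ElemTheory n ι κ) := by
  induction n with
  | zero =>
    intro ι κ _ _
    exact inferInstanceAs (Finite (Set (AtomicFormula ι κ)))
  | succ n ih =>
    intro ι κ _ _
    have := ih ι (Option κ)
    exact inferInstanceAs (Finite (Set (ElemTheory n ι (Option κ))))

theorem Theory.finite (n : ℕ) : ∀ (ι : Type) [Finite ι], Finite (Theory n ι) := by
  induction n with
  | zero =>
    intro ι _
    exact ElemTheory.finite 2 ι Empty
  | succ n ih =>
    intro ι _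
    have := ih (Option ι)
    exact inferInstanceAs (Finite (Set (Theory n (Option ι))))

end Finite

/-! ### Theories of segments of ordinals -/

section Segments

variable {ι : Type} {n : ℕ} {A B : ι → Set Ordinal.{u}} {β γ μ β' γ' μ' : Ordinal.{u}}

/-- Composition theorem for segments cut into segments. -/
theorem segTheory_eq_of_pieces {I : Type*} [LinearOrder I] {p q : Ordinal.{u} → I}
    (hp : MonotoneOn p (Set.Ico β γ)) (hq : MonotoneOn q (Set.Ico β' γ'))
    {c c' d d' : I → Ordinal.{u}}
    (hc : ∀ i x, x ∈ Set.Ico β γ ∧ p x = i ↔ x ∈ Set.Ico (c i) (c' i))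
    (hd : ∀ i x, x ∈ Set.Ico β' γ' ∧ q x = i ↔ x ∈ Set.Ico (d i) (d' i))
    (h : ∀ i, segTheory n A (c i) (c' i) = segTheory n B (d i) (d' i)) :
    segTheory n A β γ = segTheory n B β' γ' := by
  have iso {p : Ordinal.{u} → I} {β γ : Ordinal.{u}} {c c' : I → Ordinal.{u}}
      (hc : ∀ i x, x ∈ Set.Ico β γ ∧ p x = i ↔ x ∈ Set.Ico (c i) (c' i))
      (A : ι → Set Ordinal.{u}) (i : I) :
      monTheory n (fibreTrace (fun x : Set.Ico β γ => p x) (fun j => {x | (x : Ordinal) ∈ A j}) i)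
        = segTheory n A (c i) (c' i) := by
    let e : {x : Set.Ico β γ // p x = i} ≃o Set.Ico (c i) (c' i) :=
      { toFun := fun x => ⟨x.1.1, (hc i _).1 ⟨x.1.2, x.2⟩⟩
        invFun := fun x => ⟨⟨x.1, ((hc i _).2 x.2).1⟩, ((hc i _).2 x.2).2⟩
        left_inv := fun x => rfl
        right_inv := fun x => rfl
        map_rel_iff' := Iff.rfl }
    exact monTheory_orderIso e n fun j x => Iff.rfl
  refine monTheory_eq_of_fibres (p := fun x : Set.Ico β γ => p x)
    (q := fun x : Set.Ico β' γ' => q x) (fun x y hxy => hp x.2 y.2 hxy)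
    (fun x y hxy => hq x.2 y.2 hxy) n fun i => ?_
  rw [iso hc, iso hd, h]

theorem segTheory_congr (h : ∀ i, ∀ x ∈ Set.Ico β γ, x ∈ A i ↔ x ∈ B i) :
    segTheory n A β γ = segTheory n B β γ :=
  monTheory_orderIso (OrderIso.refl _) n fun i x => h i x x.2

theorem segTheory_add (hμ : μ ∈ Set.Icc β γ) (hμ' : μ' ∈ Set.Icc β' γ')
    (h₁ : segTheory n A β μ = segTheory n B β' μ')
    (h₂ : segTheory n A μ γ = segTheory n B μ' γ') :
    segTheory n A β γ = segTheory n B β' γ' := by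
  have fib {β γ μ : Ordinal.{u}} (hμ : μ ∈ Set.Icc β γ) (i : Bool) (x : Ordinal.{u}) :
      x ∈ Set.Ico β γ ∧ decide (μ ≤ x) = i ↔
        x ∈ Set.Ico (bif i then μ else β) (bif i then γ else μ) := by
    cases i <;> simp <;> grind
  refine segTheory_eq_of_pieces (p := fun x => decide (μ ≤ x)) (q := fun x => decide (μ' ≤ x))
    ?_ ?_ (fib hμ) (fib hμ') (by rintro (_ | _) <;> assumption)
  all_goals
    intro x _ y _ hxy
    simp only [Bool.le_iff_imp, decide_eq_true_eq]
    exact fun h => h.trans hxy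

/-- Composition theorem for sums of `ω` segments. -/
theorem segTheory_omega {z z' : ℕ → Ordinal.{u}} (hz : Monotone z) (hz' : Monotone z')
    (hzγ : ∀ m, z m ≤ γ) (hzγ' : ∀ m, z' m ≤ γ') (hγ : ∀ x < γ, ∃ m, x < z m)
    (hγ' : ∀ x < γ', ∃ m, x < z' m)
    (h : ∀ m, segTheory n A (z m) (z (m + 1)) = segTheory n B (z' m) (z' (m + 1))) :
    segTheory n A (z 0) γ = segTheory n B (z' 0) γ' := by
  classical
  -- The index of the piece containing x. As z is only monotone, some pieces may be empty.
  let p (z : ℕ → Ordinal.{u}) (x : Ordinal.{u}) : ℕ := sInf {m | x < z (m + 1)}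
  have ex {z : ℕ → Ordinal.{u}} {γ : Ordinal.{u}} (hz : Monotone z) (hγ : ∀ x < γ, ∃ m, x < z m)
      {x : Ordinal.{u}} (hx : x < γ) : {m | x < z (m + 1)}.Nonempty := by
    obtain ⟨m, hm⟩ := hγ x hx
    exact ⟨m, hm.trans_le (hz m.le_succ)⟩
  have mono {z : ℕ → Ordinal.{u}} {γ : Ordinal.{u}} (hz : Monotone z)
      (hγ : ∀ x < γ, ∃ m, x < z m) : MonotoneOn (p z) (Set.Ico (z 0) γ) := by
    intro x _ y hy hxy
    exact Nat.sInf_le (hxy.trans_lt (Nat.sInf_mem (ex hz hγ hy.2)))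
  have fib {z : ℕ → Ordinal.{u}} {γ : Ordinal.{u}} (hz : Monotone z) (hzγ : ∀ m, z m ≤ γ)
      (hγ : ∀ x < γ, ∃ m, x < z m) (m : ℕ) (x : Ordinal.{u}) :
      x ∈ Set.Ico (z 0) γ ∧ p z x = m ↔ x ∈ Set.Ico (z m) (z (m + 1)) := by
    constructor
    · rintro ⟨⟨h0, hx⟩, rfl⟩
      refine ⟨?_, Nat.sInf_mem (ex hz hγ hx)⟩
      by_contra! hlt
      rcases hm : p z x with _ | m
      · rw [hm] at hlt
        exact hlt.not_ge h0
      · rw [hm] at hlt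
        exact Nat.notMem_of_lt_sInf (hm ▸ m.lt_succ_self : m < p z x) hlt
    · rintro ⟨h1, h2⟩
      refine ⟨⟨(hz m.zero_le).trans h1, h2.trans_le (hzγ _)⟩, le_antisymm (Nat.sInf_le h2) ?_⟩
      refine le_csInf ⟨m, h2⟩ fun k hk => ?_
      by_contra! hlt
      exact (hk.trans_le (hz hlt)).not_ge h1
  exact segTheory_eq_of_pieces (mono hz hγ) (mono hz' hγ') (fib hz hzγ hγ) (fib hz' hzγ' hγ') h

end Segments

/-! ### Clubs and sequences of length `ω` -/

section Clubs

variable {δ γ : Ordinal.{u}}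

theorem isSuccLimit_of_aleph0_lt_cof (hδ : ℵ₀ < δ.cof) : Order.IsSuccLimit δ :=
  one_lt_cof_iff.1 (aleph0_le_cof_iff.1 hδ.le)

theorem isClubIn_iff {C : Set Ordinal.{u}} :
    IsClubIn δ C ↔ C ⊆ Set.Iio δ ∧
      (∀ S ⊆ C, S.Nonempty → ∀ x < δ, IsLUB S x → x ∈ C) ∧ ∀ x < δ, ∃ y ∈ C, x ≤ y := by
  refine and_congr_right fun hC => ⟨fun h => ⟨fun S hS hne x hx hlub => ?_, fun x hx => ?_⟩,
    fun h => ⟨fun d hd hne _ x hx => ?_, fun x => ?_⟩⟩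
  · refine h.isLUB_mem (t := {y : Set.Iio δ | (y : Ordinal) ∈ S}) (x := ⟨x, hx⟩)
      (fun y hy => hS hy) ?_ ⟨fun y hy => hlub.1 hy, fun b hb => hlub.2 fun y hy => ?_⟩
    · obtain ⟨y, hy⟩ := hne
      exact ⟨⟨y, hC (hS hy)⟩, hy⟩
    · exact hb (a := ⟨y, hC (hS hy)⟩) hy
  · obtain ⟨y, hy, hxy⟩ := h.isCofinal ⟨x, hx⟩
    exact ⟨y, hy, hxy⟩
  · refine h.1 (Subtype.val '' d) ?_ (hne.image _) x x.2 ⟨?_, fun b hb => ?_⟩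
    · rintro _ ⟨y, hy, rfl⟩
      exact hd hy
    · rintro _ ⟨y, hy, rfl⟩
      exact hx.1 hy
    · by_contra! hlt
      have hle : x ≤ ⟨b, hlt.trans x.2⟩ := hx.2 fun y hy => hb ⟨y, hy, rfl⟩
      exact hle.not_gt hlt
  · obtain ⟨y, hy, hxy⟩ := h.2 x x.2
    exact ⟨⟨y, hC hy⟩, hy, hxy⟩

theorem IsClubIn.iInter {κ : Type} [Countable κ] [Nonempty κ] (hδ : ℵ₀ < δ.cof)
    {C : κ → Set Ordinal.{u}} (hC : ∀ k, IsClubIn δ (C k)) : IsClubIn δ (⋂ k, C k) := by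
  refine ⟨(Set.iInter_subset _ (Classical.arbitrary κ)).trans (hC _).1, ?_⟩
  have hcof : Order.cof (Set.Iio δ) ≠ ℵ₀ := by
    rw [cof_Iio, ← lift_cof]
    intro h
    rw [Cardinal.lift_eq_aleph0] at h
    exact hδ.ne' h
  convert IsClub.iInter_of_countable hcof fun k => (hC k).2
  ext x
  simp

theorem IsClubIn.inter (hδ : ℵ₀ < δ.cof) {C D : Set Ordinal.{u}} (hC : IsClubIn δ C)
    (hD : IsClubIn δ D) : IsClubIn δ (C ∩ D) := by
  rw [Set.inter_eq_iInter]
  exact IsClubIn.iInter hδ (by rintro (_ | _) <;> assumption)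

theorem cof_eq_aleph0_of_isLUB {z : ℕ → Ordinal.{u}} (hz : StrictMono z)
    (hγ : IsLUB (Set.range z) γ) : γ.cof = ℵ₀ := by
  have h := lift_cof_iSup hz
  rw [iSup, hγ.csSup_eq (Set.range_nonempty z)] at h
  simpa using h

/-- Iterate a choice function for P from y; uncountable cofinality keeps the supremum below δ. -/
theorem exists_omega_seq (hδ : ℵ₀ < δ.cof) {P : Ordinal.{u} → Ordinal.{u} → Prop}
    (hP : ∀ y < δ, ∃ y' < δ, y < y' ∧ P y y') {y : Ordinal.{u}} (hy : y < δ) :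
    ∃ z : ℕ → Ordinal.{u}, ∃ s < δ, z 0 = y ∧ StrictMono z ∧ (∀ m, P (z m) (z (m + 1))) ∧
      IsLUB (Set.range z) s ∧ s.cof = ℵ₀ := by
  choose! f hfδ hf hfP using hP
  let z : ℕ → Ordinal.{u} := fun m => f^[m] y
  have hzs (m : ℕ) : z (m + 1) = f (z m) := Function.iterate_succ_apply' f m y
  have hzδ (m : ℕ) : z m < δ := by
    induction m with
    | zero => exact hy
    | succ m ih => exact hzs m ▸ hfδ _ ih
  have hz : StrictMono z := strictMono_nat_of_lt_succ fun m => hzs m ▸ hf _ (hzδ m)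
  have hlub : IsLUB (Set.range z) (⨆ m, z m) :=
    isLUB_ciSup ⟨δ, by rintro _ ⟨m, rfl⟩; exact (hzδ m).le⟩
  refine ⟨z, _, lift_iSup_lt_of_lt_cof ?_ hzδ, rfl, hz, fun m => hzs m ▸ hfP _ (hzδ m), hlub,
    cof_eq_aleph0_of_isLUB hz hlub⟩
  simpa using hδ

theorem IsClubIn.exists_cof_eq_aleph0 (hδ : ℵ₀ < δ.cof) {C : Set Ordinal.{u}}
    (hC : IsClubIn δ C) {β : Ordinal.{u}} (hβ : β < δ) : ∃ γ ∈ C, β < γ ∧ γ.cof = ℵ₀ := by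
  obtain ⟨hCδ, hcl, hub⟩ := isClubIn_iff.1 hC
  have hlim := isSuccLimit_of_aleph0_lt_cof hδ
  obtain ⟨z, s, hs, h0, hz, hzC, hlub, hcof⟩ := exists_omega_seq hδ (P := fun _ y => y ∈ C)
    (fun y hy => by
      obtain ⟨y', hy', hle⟩ := hub (Order.succ y) (hlim.succ_lt hy)
      exact ⟨y', hCδ hy', Order.succ_le_iff.1 hle, hy'⟩) hβ
  -- The first term is β, which need not lie in C, so it is dropped before closedness is applied.
  have hlub' : IsLUB (Set.range fun m => z (m + 1)) s := by
    refine ⟨?_, fun b hb => hlub.2 ?_⟩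
    · rintro _ ⟨m, rfl⟩
      exact hlub.1 ⟨m + 1, rfl⟩
    · rintro _ ⟨m, rfl⟩
      exact (hz.monotone m.le_succ).trans (hb ⟨m, rfl⟩)
  refine ⟨s, hcl _ ?_ (Set.range_nonempty _) s hs hlub', ?_, hcof⟩
  · rintro _ ⟨m, rfl⟩
    exact hzC m
  · rw [← h0]
    exact (hz Nat.zero_lt_one).trans_le (hlub.1 ⟨1, rfl⟩)

/-- In an ordinal of cofinality `ω`, chains of related elements can be chosen cofinal. -/
theorem exists_cofinal_seq (hγ : γ.cof = ℵ₀) {Q : Ordinal.{u} → Prop}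
    {R : Ordinal.{u} → Ordinal.{u} → Prop}
    (h : ∀ x < γ, Q x → ∀ b < γ, ∃ y < γ, b < y ∧ Q y ∧ R x y)
    {x₀ : Ordinal.{u}} (hx₀ : x₀ < γ) (hQ : Q x₀) :
    ∃ z : ℕ → Ordinal.{u}, z 0 = x₀ ∧ StrictMono z ∧ (∀ m, z m < γ) ∧ (∀ m, Q (z m)) ∧
      (∀ m, R (z m) (z (m + 1))) ∧ ∀ x < γ, ∃ m, x < z m := by
  obtain ⟨e, heγ, he⟩ : ∃ e : ℕ → Ordinal.{u}, (∀ m, e m < γ) ∧ ∀ x < γ, ∃ m, x ≤ e m := by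
    obtain ⟨f, hf⟩ := exists_isFundamentalSeq (o := γ) (a := ω) (by rw [hγ, ord_aleph0])
    refine ⟨fun m => f ⟨m, natCast_lt_omega0 m⟩, fun m => (f _).2, fun x hx => ?_⟩
    obtain ⟨_, ⟨⟨i, hi⟩, rfl⟩, hxi⟩ := hf.isCofinal_range ⟨x, hx⟩
    obtain ⟨m, rfl⟩ := lt_omega0.1 hi
    exact ⟨m, hxi⟩
  choose! g hgγ hgb hgQ hgR using h
  -- Passing above `e m` at each step makes the sequence cofinal.
  let z : ℕ → Ordinal.{u} := fun m => Nat.rec x₀ (fun m x => g x (max x (e m))) m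
  have hz (m : ℕ) : z m < γ ∧ Q (z m) := by
    induction m with
    | zero => exact ⟨hx₀, hQ⟩
    | succ m ih =>
      have hm := max_lt ih.1 (heγ m)
      exact ⟨hgγ _ ih.1 ih.2 _ hm, hgQ _ ih.1 ih.2 _ hm⟩
  have hmax (m : ℕ) : max (z m) (e m) < z (m + 1) :=
    hgb _ (hz m).1 (hz m).2 _ (max_lt (hz m).1 (heγ m))
  refine ⟨z, rfl, strictMono_nat_of_lt_succ fun m => (le_max_left _ _).trans_lt (hmax m),
    fun m => (hz m).1, fun m => (hz m).2,
    fun m => hgR _ (hz m).1 (hz m).2 _ (max_lt (hz m).1 (heγ m)), fun x hx => ?_⟩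
  obtain ⟨m, hm⟩ := he x hx
  exact ⟨m + 1, (hm.trans (le_max_right _ _)).trans_lt (hmax m)⟩

end Clubs

/-! ### Existence of witnessing clubs -/

section Witnesses

variable {δ : Ordinal.{u}} {ι : Type} {A : ι → Set Ordinal.{u}}

/-- Ramsey's theorem for the colouring of pairs by theories of segments, along a set whose bounded
parts have fewer than `cf δ` elements. -/
theorem exists_homogeneous [Finite ι] (hδ : ℵ₀ < δ.cof) (k : ℕ) (A : ι → Set Ordinal.{u}) :
    ∃ (Q : Set Ordinal.{u}) (t : Theory k ι), Q.Nonempty ∧ Q ⊆ Set.Iio δ ∧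
      (∀ x ∈ Q, ∀ b < δ, ∃ z ∈ Q, b < z ∧ segTheory k A x z = t) ∧
      ∀ y < δ, ∀ g : Ordinal.{u} → Ordinal.{u}, (∀ x ∈ Q, g x < δ) →
        ∃ b < δ, ∀ x ∈ Q, x ≤ y → g x ≤ b := by
  obtain ⟨F, hF⟩ := exists_isFundamentalSeq (o := δ) rfl
  have hlim : Order.IsSuccLimit δ.cof.ord := isSuccLimit_of_aleph0_lt_cof (by rwa [cof_ord_cof])
  have hne : Nonempty (Set.Iio δ.cof.ord) := ⟨⟨0, hlim.bot_lt⟩⟩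
  have hmax : NoMaxOrder (Set.Iio δ.cof.ord) :=
    ⟨fun x => ⟨⟨Order.succ x, hlim.succ_lt x.2⟩, Order.lt_succ (x : Ordinal)⟩⟩
  have := Theory.finite k ι
  -- An ultrafilter containing all final segments turns finite colourings into limits: `t i` is the
  -- limit colour of the pairs starting at i, and t' the limit of the `t i`. Points with limit
  -- colour t' form Q; each has cofinally many later partners in Q of colour t'.
  let U : Ultrafilter (Set.Iio δ.cof.ord) := Ultrafilter.of Filter.atTop
  have hU : (U : Filter (Set.Iio δ.cof.ord)) ≤ Filter.atTop := Ultrafilter.of_le _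
  have pigeon (c : Set.Iio δ.cof.ord → Theory k ι) : ∃ t, ∀ᶠ j in U, c j = t := by
    obtain ⟨t, ht⟩ := Ultrafilter.eq_pure_of_finite (U.map c)
    refine ⟨t, ?_⟩
    have : ({t} : Set (Theory k ι)) ∈ U.map c := ht ▸ Set.mem_singleton t
    exact this
  choose t ht using fun i => pigeon fun j => segTheory k A (F i) (F j)
  obtain ⟨t', ht'⟩ := pigeon t
  refine ⟨{x | ∃ i, t i = t' ∧ (F i : Ordinal) = x}, t', ?_, ?_, ?_, ?_⟩
  · obtain ⟨i, hi⟩ := ht'.exists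
    exact ⟨F i, i, hi, rfl⟩
  · rintro _ ⟨i, -, rfl⟩
    exact (F i).2
  · rintro _ ⟨i, hi, rfl⟩ b hb
    obtain ⟨_, ⟨j₀, rfl⟩, hj₀⟩ := hF.isCofinal_range ⟨b, hb⟩
    obtain ⟨j, ⟨hj₁, hj₂⟩, hj⟩ := ((ht i).and ht').and (hU (Filter.Ioi_mem_atTop j₀)) |>.exists
    exact ⟨F j, ⟨j, hj₂, rfl⟩, lt_of_le_of_lt hj₀ (hF.strictMono hj), hj₁.trans hi⟩
  · intro y hy g hg
    obtain ⟨_, ⟨j₀, rfl⟩, hj₀⟩ := hF.isCofinal_range ⟨y, hy⟩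
    let S : Set Ordinal.{u} :=
      Set.range fun j : {j : Set.Iio (Order.succ (j₀ : Ordinal)) //
        ∃ h : (j : Ordinal) < δ.cof.ord, t ⟨j, h⟩ = t'} => g (F ⟨j.1, j.2.choose⟩)
    have hS : ∀ x ∈ S, x < δ := by
      rintro _ ⟨⟨j, hj, hjt⟩, rfl⟩
      exact hg _ ⟨_, hjt, rfl⟩
    have hcard : #S < (Ordinal.lift.{u + 1} δ).cof := by
      refine mk_range_le.trans_lt ((mk_subtype_le _).trans_lt ?_)
      rw [Cardinal.mk_Iio_ordinal, ← lift_cof, Cardinal.lift_lt, ← lt_ord]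
      exact hlim.succ_lt j₀.2
    -- Only indices up to `j₀` contribute, fewer than cf δ of them, so the supremum stays below δ.
    refine ⟨sSup S, sSup_lt_of_lt_cof hcard hS, ?_⟩
    rintro _ ⟨i, hi, rfl⟩ hiy
    refine le_csSup ⟨δ, fun x hx => (hS x hx).le⟩ ⟨⟨⟨i, ?_⟩, i.2, hi⟩, rfl⟩
    have hle : F i ≤ F j₀ := hiy.trans hj₀
    exact Set.mem_Iio.2 (Order.lt_succ_iff.2 (hF.strictMono.le_iff_le.1 hle))

/-- C consists of the limits of Q below which partners of colour t can still be found cofinally.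
From x in Q to a point of C of cofinality ω runs a cofinal ω-sequence with all consecutive colours
t, so the theory is an ω-fold sum of t, whatever the endpoint. A general β is first joined to a
point of Q. -/
theorem exists_club_segTheory_eq [Finite ι] (hδ : ℵ₀ < δ.cof) (k : ℕ)
    (A : ι → Set Ordinal.{u}) :
    ∃ C, IsClubIn δ C ∧ ∀ β < δ, ∀ γ ∈ C, ∀ γ' ∈ C, β < γ → β < γ' → γ.cof = ℵ₀ → γ'.cof = ℵ₀ →
      segTheory k A β γ = segTheory k A β γ' := by
  obtain ⟨Q, t, ⟨q, hq⟩, hQδ, hQ, hbd⟩ := exists_homogeneous hδ k A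
  have hlim := isSuccLimit_of_aleph0_lt_cof hδ
  let C : Set Ordinal.{u} := {γ | γ < δ ∧ (∀ b < γ, ∃ z ∈ Q, b < z ∧ z < γ) ∧
    ∀ x ∈ Q, x < γ → ∀ b < γ, ∃ z ∈ Q, b < z ∧ z < γ ∧ segTheory k A x z = t}
  have hC : IsClubIn δ C := by
    refine isClubIn_iff.2 ⟨fun γ hγ => hγ.1, fun S hS _ γ hγ hlub => ⟨hγ, ?_, ?_⟩, ?_⟩
    · intro b hb
      obtain ⟨s, hs, hbs⟩ := (lt_isLUB_iff hlub).1 hb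
      obtain ⟨z, hz, hbz, hzs⟩ := (hS hs).2.1 b hbs
      exact ⟨z, hz, hbz, hzs.trans_le (hlub.1 hs)⟩
    · intro x hx hxγ b hb
      obtain ⟨s, hs, hbs⟩ := (lt_isLUB_iff hlub).1 (max_lt hxγ hb)
      obtain ⟨z, hz, hbz, hzs, hzt⟩ :=
        (hS hs).2.2 x hx ((le_max_left _ _).trans_lt hbs) b ((le_max_right _ _).trans_lt hbs)
      exact ⟨z, hz, hbz, hzs.trans_le (hlub.1 hs), hzt⟩
    · intro y₀ hy₀
      obtain ⟨z, s, hs, rfl, hz, hzP, hlub, -⟩ := exists_omega_seq hδ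
        (P := fun y y' => (∃ z ∈ Q, y < z ∧ z < y') ∧
          ∀ x ∈ Q, x ≤ y → ∃ z ∈ Q, y < z ∧ z < y' ∧ segTheory k A x z = t)
        (fun y hy => by
          choose! g hgQ hg hgt using fun x hx => hQ x hx y hy
          obtain ⟨b, hb, hgb⟩ := hbd y hy g fun x hx => hQδ (hgQ x hx)
          have hm := max_lt hb (hQδ (hgQ q hq))
          refine ⟨Order.succ (max b (g q)), hlim.succ_lt hm, ?_, ⟨g q, hgQ q hq, hg q hq, ?_⟩,
            fun x hx hxy => ⟨g x, hgQ x hx, hg x hx, ?_, hgt x hx⟩⟩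
          · exact (hg q hq).trans (Order.lt_succ_iff.2 (le_max_right _ _))
          · exact Order.lt_succ_iff.2 (le_max_right _ _)
          · exact Order.lt_succ_iff.2 ((hgb x hx hxy).trans (le_max_left _ _))) hy₀
      have hlt {b : Ordinal.{u}} (hb : b < s) : ∃ m, b < z m := by
        obtain ⟨_, ⟨m, rfl⟩, hm⟩ := (lt_isLUB_iff hlub).1 hb
        exact ⟨m, hm⟩
      refine ⟨s, ⟨hs, fun b hb => ?_, fun x hx hxs b hb => ?_⟩, hlub.1 ⟨0, rfl⟩⟩
      · obtain ⟨m, hm⟩ := hlt hb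
        obtain ⟨w, hw, hw₁, hw₂⟩ := (hzP m).1
        exact ⟨w, hw, hm.trans hw₁, hw₂.trans_le (hlub.1 ⟨m + 1, rfl⟩)⟩
      · obtain ⟨m, hm⟩ := hlt (max_lt hxs hb)
        obtain ⟨w, hw, hw₁, hw₂, hwt⟩ := (hzP m).2 x hx ((le_max_left _ _).trans hm.le)
        exact ⟨w, hw, ((le_max_right _ _).trans_lt hm).trans hw₁,
          hw₂.trans_le (hlub.1 ⟨m + 1, rfl⟩), hwt⟩
  have seq {γ x : Ordinal.{u}} (hγ : γ ∈ C) (hcof : γ.cof = ℵ₀) (hx : x ∈ Q) (hxγ : x < γ) :=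
    exists_cofinal_seq hcof (Q := (· ∈ Q)) (R := fun x z => segTheory k A x z = t)
      (fun x hxγ hx b hb => by
        obtain ⟨z, hz, hbz, hzγ, hzt⟩ := hγ.2.2 x hx hxγ b hb
        exact ⟨z, hzγ, hbz, hz, hzt⟩) hxγ hx
  have tail {γ γ' x : Ordinal.{u}} (hγ : γ ∈ C) (hγ' : γ' ∈ C) (hcof : γ.cof = ℵ₀)
      (hcof' : γ'.cof = ℵ₀) (hx : x ∈ Q) (hxγ : x < γ) (hxγ' : x < γ') :
      segTheory k A x γ = segTheory k A x γ' := by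
    obtain ⟨z, h0, hz, hzγ, -, hzt, hzc⟩ := seq hγ hcof hx hxγ
    obtain ⟨z', h0', hz', hzγ', -, hzt', hzc'⟩ := seq hγ' hcof' hx hxγ'
    have := segTheory_omega (n := k) (A := A) (B := A) hz.monotone hz'.monotone
      (fun m => (hzγ m).le) (fun m => (hzγ' m).le) hzc hzc' fun m => (hzt m).trans (hzt' m).symm
    rwa [h0, h0'] at this
  refine ⟨C, hC, fun β _ γ hγ γ' hγ' hβγ hβγ' hcof hcof' => ?_⟩
  obtain ⟨x, hx, hβx, hxγ⟩ := hγ.2.1 β hβγ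
  obtain ⟨x', hx', hβx', hxγ'⟩ := hγ'.2.1 β hβγ'
  obtain ⟨w, hw, hβw, hwγ, hwγ'⟩ : ∃ w ∈ Q, β < w ∧ w < γ ∧ w < γ' := by
    rcases le_total x x' with h | h
    · exact ⟨x, hx, hβx, hxγ, h.trans_lt hxγ'⟩
    · exact ⟨x', hx', hβx', h.trans_lt hxγ, hxγ'⟩
  exact segTheory_add ⟨hβw.le, hwγ.le⟩ ⟨hβw.le, hwγ'.le⟩ rfl (tail hγ hγ' hcof hcof' hw hwγ hwγ')

/-- Every finite sequence of subsets of an ordinal of uncountable cofinality has a witnessing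
club. -/
theorem exists_witnesses [Finite ι] (hδ : ℵ₀ < δ.cof) (A : ι → Set Ordinal.{u}) :
    ∃ J, Witnesses δ A J := by
  choose C hC h using fun k => exists_club_segTheory_eq hδ k A
  exact ⟨⋂ k, C k, IsClubIn.iInter hδ hC, fun β hβ γ hγ γ' hγ' h₁ h₂ h₃ h₄ k =>
    h k β hβ γ (Set.mem_iInter.1 hγ k) γ' (Set.mem_iInter.1 hγ' k) h₁ h₂ h₃ h₄⟩

/-- The club behind the chosen value and J share a point of cofinality ω above β, where both values
are read off. -/
theorem Witnesses.ATh_eq (hδ : ℵ₀ < δ.cof) {J : Set Ordinal.{u}} (hJ : Witnesses δ A J)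
    {n : ℕ} {β γ : Ordinal.{u}} (hγ : γ ∈ J) (hβγ : β < γ) (hcof : γ.cof = ℵ₀) :
    ATh n β δ A = segTheory n A β γ := by
  have hβ : β < δ := hβγ.trans (hJ.1.1 hγ)
  obtain ⟨J', hJ', h⟩ := Classical.epsilon_spec (p := fun t => ∃ J, Witnesses δ A J ∧
    ∀ γ ∈ J, β < γ → γ.cof = ℵ₀ → segTheory n A β γ = t)
    ⟨_, J, hJ, fun γ' hγ' h₁ h₂ => hJ.2 β hβ γ' hγ' γ hγ h₁ hβγ h₂ hcof n⟩
  obtain ⟨γ', ⟨hγ₁, hγ₂⟩, hβγ', hcof'⟩ := (hJ.1.inter hδ hJ'.1).exists_cof_eq_aleph0 hδ hβ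
  exact (h γ' hγ₂ hβγ' hcof').symm.trans (hJ.2 β hβ γ' hγ₁ γ hγ hβγ' hβγ hcof' hcof n)

end Witnesses

/-! ### Sums along closed sets -/

section ClosedSums

variable {ι : Type} {n : ℕ} {A B : ι → Set Ordinal.{u}} {β γ : Ordinal.{u}}

/-- If `[β, γ)` is cut along a closed set `D` whose points are followed by points of `D` with
equal theories in between, then the theories on all of `[β, γ)` are equal. -/
theorem segTheory_eq_of_closed {D : Set Ordinal.{u}} (hβ : β ∈ D)
    (hcl : ∀ S ⊆ D, S.Nonempty → ∀ x < γ, IsLUB S x → x ∈ D)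
    (hstep : ∀ d ∈ D, d < γ → ∃ d' ∈ D, d < d' ∧ d' < γ ∧
      segTheory n A d d' = segTheory n B d d') :
    segTheory n A β γ = segTheory n B β γ := by
  classical
  choose! N hND hN hNγ hNth using hstep
  -- The value outside D or beyond γ is immaterial; the successor keeps the iteration strictly
  -- increasing, hence normal.
  let N' : Ordinal.{u} → Ordinal.{u} := fun d => if d ∈ D ∧ d < γ then N d else Order.succ d
  have hN' (d : Ordinal.{u}) : d < N' d := by
    by_cases h : d ∈ D ∧ d < γ
    · simpa only [N', if_pos h] using hN d h.1 h.2
    · simpa only [N', if_neg h] using Order.lt_succ d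
  let f : Ordinal.{u} → Ordinal.{u} := fun ξ =>
    limitRecOn ξ β (fun _ x => N' x) fun ξ _ ih => ⨆ i : Set.Iio ξ, ih i i.2
  have f_zero : f 0 = β := limitRecOn_zero ..
  have f_succ (ξ : Ordinal.{u}) : f (Order.succ ξ) = N' (f ξ) := limitRecOn_add_one ..
  have f_limit {ξ : Ordinal.{u}} (hξ : Order.IsSuccLimit ξ) : IsLUB (f '' Set.Iio ξ) (f ξ) := by
    have : f ξ = ⨆ i : Set.Iio ξ, f i := limitRecOn_limit _ _ _ _ hξ
    have hne : Nonempty (Set.Iio ξ) := ⟨⟨0, hξ.bot_lt⟩⟩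
    rw [this, Set.image_eq_range]
    exact isLUB_ciSup bddAbove_of_small
  have hf : Order.IsNormal f :=
    Order.IsNormal.of_succ_lt (fun ξ => f_succ ξ ▸ hN' (f ξ)) f_limit
  have hfD (ξ : Ordinal.{u}) : f ξ < γ → f ξ ∈ D := by
    induction ξ using limitRecOn with
    | zero => exact fun _ => f_zero ▸ hβ
    | add_one ξ ih =>
      intro h
      have hlt : f ξ < γ := (hf.strictMono (Order.lt_succ ξ)).trans h
      have := f_succ ξ
      rw [show N' (f ξ) = N (f ξ) from if_pos ⟨ih hlt, hlt⟩] at this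
      exact (this ▸ hND _ (ih hlt) hlt : f (Order.succ ξ) ∈ D)
    | limit ξ hξ ih =>
      intro h
      refine hcl (f '' Set.Iio ξ) ?_ ⟨f 0, 0, hξ.bot_lt, rfl⟩ _ h (f_limit hξ)
      rintro _ ⟨η, hη, rfl⟩
      exact ih η hη ((hf.strictMono hη).trans h)
  let p : Ordinal.{u} → Ordinal.{u} := fun x => sInf {ξ | x < f (Order.succ ξ)}
  have hne (x : Ordinal.{u}) : {ξ | x < f (Order.succ ξ)}.Nonempty :=
    ⟨x, hf.strictMono.le_apply.trans_lt (hf.strictMono (Order.lt_succ x))⟩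
  have hp {x : Ordinal.{u}} (hx : β ≤ x) (ξ : Ordinal.{u}) :
      p x = ξ ↔ f ξ ≤ x ∧ x < f (Order.succ ξ) := by
    obtain ⟨η, hη, hη'⟩ := hf.exists_map_le_lt_map_succ (f_zero.trans_le hx)
    have : p x = η := by
      refine le_antisymm (csInf_le' hη') (le_csInf (hne x) fun ζ hζ => ?_)
      exact Order.lt_succ_iff.1 (hf.strictMono.lt_iff_lt.1 (hη.trans_lt hζ))
    rw [this]
    refine ⟨fun h => h ▸ ⟨hη, hη'⟩, fun h => le_antisymm ?_ ?_⟩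
    · exact Order.lt_succ_iff.1 (hf.strictMono.lt_iff_lt.1 (hη.trans_lt h.2))
    · exact Order.lt_succ_iff.1 (hf.strictMono.lt_iff_lt.1 (h.1.trans_lt hη'))
  have mono : MonotoneOn p (Set.Ico β γ) := fun x _ y _ hxy =>
    csInf_le' (hxy.trans_lt (csInf_mem (hne y)))
  have fib (ξ x : Ordinal.{u}) : x ∈ Set.Ico β γ ∧ p x = ξ ↔
      x ∈ Set.Ico (min (f ξ) γ) (min (f (Order.succ ξ)) γ) := by
    have hβξ : β ≤ f ξ := f_zero ▸ hf.monotone zero_le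
    constructor
    · rintro ⟨⟨hβx, hxγ⟩, h⟩
      rw [hp hβx] at h
      exact ⟨(min_le_left _ _).trans h.1, lt_min h.2 hxγ⟩
    · rintro ⟨h₁, h₂⟩
      obtain ⟨h₂, h₃⟩ := lt_min_iff.1 h₂
      have h₁ := (min_le_iff.1 h₁).resolve_right h₃.not_ge
      exact ⟨⟨hβξ.trans h₁, h₃⟩, (hp (hβξ.trans h₁) ξ).2 ⟨h₁, h₂⟩⟩
  refine segTheory_eq_of_pieces mono mono fib fib fun ξ => ?_
  rcases lt_or_ge (f ξ) γ with h | h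
  · have hs : f (Order.succ ξ) = N (f ξ) := (f_succ ξ).trans (if_pos ⟨hfD ξ h, h⟩)
    have hlt := hNγ _ (hfD ξ h) h
    rw [hs, min_eq_left h.le, min_eq_left hlt.le]
    exact hNth _ (hfD ξ h) h
  -- Pieces starting at or beyond γ are truncated to the empty segment.
  · refine segTheory_congr fun i x hx => ?_
    rw [min_eq_right h] at hx
    exact absurd (hx.1.trans_lt hx.2) (min_le_right _ _).not_gt

end ClosedSums

/-! ### Shufflings -/

section Shuffling

variable {lam : Ordinal.{u}} {α : Ordinal.{u} → Ordinal.{u}}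

theorem isLUB_image_of_continuous (hα : StrictMonoOn α (Set.Iio lam))
    (hcont : ∀ j < lam, Order.IsSuccLimit j → IsLUB (α '' Set.Iio j) (α j))
    {S : Set Ordinal.{u}} {e : Ordinal.{u}} (he : e < lam) (hS : S.Nonempty) (hlub : IsLUB S e) :
    IsLUB (α '' S) (α e) := by
  refine ⟨?_, fun w hw => ?_⟩
  · rintro _ ⟨d, hd, rfl⟩
    exact hα.monotoneOn ((hlub.1 hd).trans_lt he) he (hlub.1 hd)
  · by_cases heS : e ∈ S
    · exact hw ⟨e, heS, rfl⟩
    · refine (hcont e he (hlub.isSuccLimit_of_notMem hS heS)).2 ?_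
      rintro _ ⟨d, hd, rfl⟩
      obtain ⟨d', hd', hlt⟩ := (lt_isLUB_iff hlub).1 hd
      have hd'lam := (hlub.1 hd').trans_lt he
      exact (hα (hlt.trans hd'lam) hd'lam hlt).le.trans (hw ⟨d', hd', rfl⟩)

theorem cof_apply_of_continuous (hα : StrictMonoOn α (Set.Iio lam))
    (hcont : ∀ j < lam, Order.IsSuccLimit j → IsLUB (α '' Set.Iio j) (α j))
    {j : Ordinal.{u}} (hj : j < lam) (hjl : Order.IsSuccLimit j) : (α j).cof = j.cof := by
  have hmono : StrictMono fun i : Set.Iio j => α i := fun x y hxy =>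
    hα (x.2.trans hj) (y.2.trans hj) hxy
  rw [← cof_iSup_Iio hmono hjl.isSuccPrelimit, iSup, ← Set.image_eq_range,
    (hcont j hj hjl).csSup_eq ⟨_, 0, hjl.bot_lt, rfl⟩]

/-- Theories of the segments of a sequence `X` which on each `[α i, α (i + 1))` agrees with one of
two sequences `P b`, when the choice is constant on a club below every index of uncountable
cofinality and the theories `s b` of final segments recur. -/
theorem segTheory_of_piecewise {ι : Type} {n : ℕ} (hlim : Order.IsSuccLimit lam)
    (hα : StrictMonoOn α (Set.Iio lam))
    (hcont : ∀ j < lam, Order.IsSuccLimit j → IsLUB (α '' Set.Iio j) (α j))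
    (hcof : ∀ i < lam, (α (i + 1)).cof = ℵ₀)
    {P : Bool → ι → Set Ordinal.{u}} {s : Bool → Ordinal.{u} → Theory n ι}
    (hs : ∀ b i j, i < j → j < lam → (α j).cof = ℵ₀ → segTheory n (P b) (α i) (α j) = s b i)
    (hrec : ∀ b b' : Bool, ∀ j < lam, (α j).cof = ℵ₀ → ∃ k : ℕ, s b (j + k) = s b' j)
    {c : Ordinal.{u} → Bool}
    (hc : ∀ j < lam, ℵ₀ < j.cof → ∃ C, IsClubIn j C ∧ ∀ i ∈ C, c i = c j)
    {X : ι → Set Ordinal.{u}}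
    (hX : ∀ i < lam, ∀ r, ∀ x ∈ Set.Ico (α i) (α (i + 1)), x ∈ X r ↔ x ∈ P (c i) r) :
    ∀ j < lam, (α j).cof = ℵ₀ → ∀ i < j, segTheory n X (α i) (α j) = s (c i) i := by
  have hsucc {i : Ordinal.{u}} (hi : i < lam) : i + 1 < lam := hlim.succ_lt hi
  have hlt {i j : Ordinal.{u}} (hij : i < j) (hj : j < lam) : α i < α j := hα (hij.trans hj) hj hij
  -- Absorption: the model for the two pieces is P_b on [α_i, α_{j+k+1}), cut at α_{j+k}. The extra
  -- 1 makes the second piece nonempty with an endpoint of cofinality ω.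
  have absorb {b b' : Bool} {i j γ : Ordinal.{u}} (hij : i < j) (hj : j < lam)
      (hjc : (α j).cof = ℵ₀) (hγ : α j ≤ γ) (h₁ : segTheory n X (α i) (α j) = s b i)
      (h₂ : segTheory n X (α j) γ = s b' j) : segTheory n X (α i) γ = s b i := by
    obtain ⟨k, hk⟩ := hrec b b' j hj hjc
    have hjk (k : ℕ) : j + k < lam ∧ (α (j + k)).cof = ℵ₀ := by
      induction k with
      | zero => simpa using ⟨hj, hjc⟩
      | succ k ih =>
        rw [Nat.cast_succ, ← add_assoc]
        exact ⟨hsucc ih.1, hcof _ ih.1⟩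
    have hik : i < j + k := hij.trans_le le_self_add
    have hk₁ : j + k < j + k + 1 := Order.lt_succ _
    have hk₁lam := hsucc (hjk k).1
    rw [← hs b i (j + k + 1) (hik.trans hk₁) hk₁lam (hcof _ (hjk k).1)]
    refine segTheory_add ⟨(hlt hij hj).le, hγ⟩ ⟨(hlt hik (hjk k).1).le, (hlt hk₁ hk₁lam).le⟩ ?_ ?_
    · rw [h₁, hs b i _ hik (hjk k).1 (hjk k).2]
    · rw [h₂, hs b _ _ hk₁ hk₁lam (hcof _ (hjk k).1), hk]
  intro j
  induction j using WellFoundedLT.induction with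
  | ind j ih =>
  intro hj hjc i hij
  rcases Ordinal.zero_or_succ_or_isSuccLimit j with rfl | ⟨j, rfl⟩ | hjl
  · exact absurd hij (not_lt_zero)
  · have hj' : j < lam := (Order.lt_succ j).trans hj
    have hjj : j < Order.succ j := Order.lt_succ j
    rcases (Order.lt_succ_iff.1 hij).eq_or_lt with rfl | hij'
    · rw [← hs (c i) i _ hij hj hjc]
      exact segTheory_congr (hX i hj')
    have pure : segTheory n X (α j) (α (Order.succ j)) =
        segTheory n (P (c j)) (α j) (α (Order.succ j)) := segTheory_congr (hX j hj')
    by_cases hjc' : (α j).cof = ℵ₀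
    · exact absorb hij' hj' hjc' (hlt hjj hj).le (ih j hjj hj' hjc' i hij')
        (pure.trans (hs (c j) j _ hjj hj hjc))
    have hjl : Order.IsSuccLimit j := by
      rcases Ordinal.zero_or_succ_or_isSuccLimit j with rfl | ⟨k, rfl⟩ | hjl
      · exact absurd hij' (not_lt_zero)
      · exact absurd (hcof k ((Order.lt_succ k).trans hj')) hjc'
      · exact hjl
    rw [cof_apply_of_continuous hα hcont hj' hjl] at hjc'
    have hunc : ℵ₀ < j.cof :=
      lt_of_le_of_ne (aleph0_le_cof_iff.2 (one_lt_cof_iff.2 hjl)) (Ne.symm hjc')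
    obtain ⟨C, hC, hCc⟩ := hc j hj' hunc
    obtain ⟨hCj, hCcl, -⟩ := isClubIn_iff.1 hC
    -- Club points of cofinality ω are needed as right endpoints, since only there do the induction
    -- hypothesis and `hs` apply.
    have next {d : Ordinal.{u}} (hd : d < j) : ∃ e ∈ C, d < e ∧ (α e).cof = ℵ₀ := by
      obtain ⟨e, he, hde, hec⟩ := hC.exists_cof_eq_aleph0 hunc hd
      refine ⟨e, he, hde, ?_⟩
      rw [cof_apply_of_continuous hα hcont ((hCj he).trans hj'), hec]
      rw [← one_lt_cof_iff, ← aleph0_le_cof_iff, hec]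
    obtain ⟨e, he, hie, hec⟩ := next hij'
    have hej : e < j := hCj he
    -- Between successive chosen club points the induction hypothesis gives X the theory of P_{c j},
    -- as the choice on the club is `c j`.
    have hmid : segTheory n X (α e) (α j) = segTheory n (P (c j)) (α e) (α j) := by
      refine segTheory_eq_of_closed (D := α '' (C ∩ Set.Ici e)) ⟨e, ⟨he, Set.self_mem_Ici⟩, rfl⟩ ?_ ?_
      · intro S hS hSne x hx hlub
        -- Closedness is transferred from C to its image by continuity of α, working with indices.
        let S' : Set Ordinal.{u} := {d | (d ∈ C ∧ e ≤ d) ∧ α d ∈ S}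
        have hSS' : α '' S' = S := by
          ext y
          constructor
          · rintro ⟨d, hd, rfl⟩
            exact hd.2
          · intro hy
            obtain ⟨d, hd, rfl⟩ := hS hy
            exact ⟨d, ⟨hd, hy⟩, rfl⟩
        have hne : S'.Nonempty := Set.image_nonempty.1 (hSS' ▸ hSne)
        obtain ⟨_, ⟨d, hd, rfl⟩, hxd⟩ := (lt_isLUB_iff (hcont j hj' hjl)).1 hx
        have hdj : d < j := hd
        have hbd : d ∈ upperBounds S' := fun d' hd' => by
          have : α d' < α d := (hlub.1 hd'.2).trans_lt hxd
          exact ((hα.lt_iff_lt ((hCj hd'.1.1).trans hj') (hdj.trans hj')).1 this).le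
        have hlub' : IsLUB S' (sSup S') := isLUB_csSup hne ⟨d, hbd⟩
        have hlt' : sSup S' < j := (hlub'.2 hbd).trans_lt hdj
        have himg := isLUB_image_of_continuous hα hcont (hlt'.trans hj') hne hlub'
        rw [hSS'] at himg
        refine ⟨sSup S', ⟨hCcl S' (fun d hd => hd.1.1) hne _ hlt' hlub', ?_⟩, himg.unique hlub⟩
        obtain ⟨d', hd'⟩ := hne
        exact hd'.1.2.trans (hlub'.1 hd')
      · rintro _ ⟨d, ⟨hdC, hed⟩, rfl⟩ -
        obtain ⟨d', hd', hdd', hdc⟩ := next (hCj hdC)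
        have hd'j : d' < j := hCj hd'
        refine ⟨α d', ⟨d', ⟨hd', hed.trans hdd'.le⟩, rfl⟩, hlt hdd' (hd'j.trans hj'),
          hlt hd'j hj', ?_⟩
        rw [ih d' (hd'j.trans hjj) (hd'j.trans hj') hdc d hdd', hCc d hdC,
          hs (c j) d d' hdd' (hd'j.trans hj') hdc]
    refine absorb hie (hej.trans hj') hec (hlt (hej.trans hjj) hj).le
      (ih e (hej.trans hjj) (hej.trans hj') hec i hie) (b' := c j) ?_
    rw [← hs (c j) e _ (hej.trans hjj) hj hjc]
    have hmem : α j ∈ Set.Icc (α e) (α (Order.succ j)) := ⟨(hlt hej hj').le, (hlt hjj hj).le⟩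
    exact segTheory_add hmem hmem hmid pure
  · have hjc' : j.cof = ℵ₀ := by rw [← cof_apply_of_continuous hα hcont hj hjl, hjc]
    -- Pigeonhole on successor indices, whose α-values have cofinality ω: one of the two choices
    -- occurs cofinally.
    obtain ⟨b, hb⟩ : ∃ b, ∀ x < j, ∃ y < j, x < y ∧ c y = b ∧ (α y).cof = ℵ₀ := by
      by_contra! h
      obtain ⟨x, hx, hx'⟩ := h true
      obtain ⟨y, hy, hy'⟩ := h false
      have hm : max x y < j := max_lt hx hy
      have hmc := hcof _ (hm.trans hj)
      have hxm : x < max x y + 1 := Order.lt_succ_iff.2 (le_max_left x y)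
      have hym : y < max x y + 1 := Order.lt_succ_iff.2 (le_max_right x y)
      cases hcm : c (max x y + 1)
      · exact hy' _ (hjl.succ_lt hm) hym hcm hmc
      · exact hx' _ (hjl.succ_lt hm) hxm hcm hmc
    obtain ⟨e, hej, hie, heb, hec⟩ := hb i hij
    obtain ⟨z, hz0, hz, hzj, hzQ, -, hzc⟩ := exists_cofinal_seq hjc'
      (Q := fun y => c y = b ∧ (α y).cof = ℵ₀) (R := fun _ _ => True)
      (fun x _ _ y hy => by
        obtain ⟨w, hw, hyw, hwb⟩ := hb y hy
        exact ⟨w, hw, hyw, hwb, trivial⟩) hej ⟨heb, hec⟩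
    have hαz : Monotone fun m => α (z m) := fun m m' h =>
      hα.monotoneOn ((hzj m).trans hj) ((hzj m').trans hj) (hz.monotone h)
    have hαc : ∀ x < α j, ∃ m, x < α (z m) := fun x hx => by
      obtain ⟨_, ⟨d, hd, rfl⟩, hxd⟩ := (lt_isLUB_iff (hcont j hj hjl)).1 hx
      obtain ⟨m, hm⟩ := hzc d hd
      exact ⟨m, hxd.trans (hlt hm ((hzj m).trans hj))⟩
    have hsum := segTheory_omega (n := n) (A := X) (B := P b) hαz hαz
      (fun m => (hlt (hzj m) hj).le) (fun m => (hlt (hzj m) hj).le) hαc hαc fun m => by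
        have hzm := hz m.lt_succ_self
        rw [ih _ (hzj _) ((hzj _).trans hj) (hzQ _).2 _ hzm, (hzQ m).1,
          hs b _ _ hzm ((hzj _).trans hj) (hzQ _).2]
    simp only [hz0] at hsum
    exact absorb hie (hej.trans hj) hec (hlt hej hj).le (ih e hej (hej.trans hj) hec i hie)
      (hsum.trans (hs b e j hej hj hjc))

theorem mem_shuffle_iff (hα : StrictMonoOn α (Set.Iio lam)) {a X Y : Set Ordinal.{u}}
    (ha : a ⊆ Set.Iio lam) {i x : Ordinal.{u}} (hi : i < lam)
    (hx : x ∈ Set.Ico (α i) (α (i + 1))) :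
    x ∈ shuffle lam α a X Y ↔ i ∈ a ∧ x ∈ X ∨ i ∉ a ∧ x ∈ Y := by
  have le {i j : Ordinal.{u}} (hj : j < lam) (hx : x ∈ Set.Ico (α i) (α (i + 1)))
      (hx' : x ∈ Set.Ico (α j) (α (j + 1))) : j ≤ i := by
    by_contra! h
    have h' : i + 1 ≤ j := Order.succ_le_iff.2 h
    exact (hx.2.trans_le (hα.monotoneOn (h'.trans_lt hj) hj h')).not_ge hx'.1
  have uniq {j : Ordinal.{u}} (hj : j < lam) (hx' : x ∈ Set.Ico (α j) (α (j + 1))) : j = i :=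
    le_antisymm (le hj hx hx') (le hi hx' hx)
  simp only [shuffle, Set.mem_union, Set.mem_iUnion, Set.mem_inter_iff, exists_prop, Set.mem_sdiff,
    Set.mem_Iio]
  constructor
  · rintro (⟨j, hj, hxX, hx'⟩ | ⟨j, ⟨hj, hja⟩, hxY, hx'⟩)
    · obtain rfl := uniq (ha hj) hx'
      exact Or.inl ⟨hj, hxX⟩
    · obtain rfl := uniq hj hx'
      exact Or.inr ⟨hja, hxY⟩
  · rintro (⟨hia, hxX⟩ | ⟨hia, hxY⟩)
    · exact Or.inl ⟨i, hia, hxX, hx⟩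
    · exact Or.inr ⟨i, ⟨hi, hia⟩, hxY, hx⟩

end Shuffling

/-- The enumeration of a closed set is continuous: the supremum lies in J, so it is some α_k, and k
< j would force α_{k+1} ≤ α_k. -/
theorem IsSuitable.isLUB_image {n : ℕ} {δ : Ordinal.{u}} {ι : Type} {P₀ P₁ : ι → Set Ordinal.{u}}
    {J : Set Ordinal.{u}} {α : Ordinal.{u} → Ordinal.{u}} (hJ : IsSuitable n δ P₀ P₁ J α)
    {j : Ordinal.{u}} (hj : j < δ.cof.ord) (hjl : Order.IsSuccLimit j) :
    IsLUB (α '' Set.Iio j) (α j) := by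
  obtain ⟨hJδ, hcl, -⟩ := isClubIn_iff.1 hJ.witnesses₀.1
  have hmem {i : Ordinal.{u}} (hi : i < δ.cof.ord) : α i ∈ J := hJ.image_eq ▸ ⟨i, hi, rfl⟩
  have hub : α j ∈ upperBounds (α '' Set.Iio j) := by
    rintro _ ⟨i, hi, rfl⟩
    exact (hJ.strictMonoOn (Set.mem_Iio.1 hi |>.trans hj) hj hi).le
  have hne : (α '' Set.Iio j).Nonempty := ⟨_, 0, hjl.bot_lt, rfl⟩
  have hlub := isLUB_csSup hne ⟨_, hub⟩
  have hle := hlub.2 hub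
  have hsJ : sSup (α '' Set.Iio j) ∈ J := by
    refine hcl _ ?_ hne _ (hle.trans_lt (hJδ (hmem hj))) hlub
    rintro _ ⟨i, hi, rfl⟩
    exact hmem (Set.mem_Iio.1 hi |>.trans hj)
  rw [← hJ.image_eq] at hsJ
  obtain ⟨k, hk, hks⟩ := hsJ
  have hjk : j ≤ k := by
    by_contra! hkj
    have h₁ : α (Order.succ k) ≤ α k := hks ▸ hlub.1 ⟨_, hjl.succ_lt hkj, rfl⟩
    exact (hJ.strictMonoOn hk ((hjl.succ_lt hkj).trans hj) (Order.lt_succ k)).not_ge h₁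
  have : sSup (α '' Set.Iio j) = α j :=
    le_antisymm hle (hks ▸ hJ.strictMonoOn.monotoneOn hj hk hjk)
  rwa [this] at hlub

end MonadicShuffling

/-! ### The shuffling theorem -/

theorem theorem4p5 (δ : Ordinal.{u}) (hδ : ℵ₀ < δ.cof) (l n : ℕ) (hn : 1 ≤ n)
    (P₀ P₁ : Fin l → Set Ordinal.{u})
    (hP₀ : ∀ r, P₀ r ⊆ Set.Iio δ) (hP₁ : ∀ r, P₁ r ⊆ Set.Iio δ)
    (hWA : WA n δ P₀ = WA n δ P₁)
    (J : Set Ordinal.{u}) (α : Ordinal.{u} → Ordinal.{u}) (hJ : IsSuitable n δ P₀ P₁ J α)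
    (a : Set Ordinal.{u}) (ha : IsSemiClub δ.cof.ord a) :
    ATh n 0 δ (fun r => shuffle δ.cof.ord α a (P₀ r) (P₁ r)) = ATh n 0 δ P₀ ∧
      ATh n 0 δ (fun r => shuffle δ.cof.ord α a (P₀ r) (P₁ r)) = ATh n 0 δ P₁ := by
  classical
  have h01 : ATh n 0 δ P₀ = ATh n 0 δ P₁ := congrArg Prod.snd hWA
  suffices h : ATh n 0 δ (fun r => shuffle δ.cof.ord α a (P₀ r) (P₁ r)) = ATh n 0 δ P₀ from
    ⟨h, h.trans h01⟩
  have hlim : Order.IsSuccLimit δ.cof.ord := isSuccLimit_of_aleph0_lt_cof (by rwa [cof_ord_cof])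
  have hδ0 : 0 < δ := by
    rw [← cof_pos]
    exact aleph0_pos.trans hδ
  have hmem {i : Ordinal.{u}} (hi : i < δ.cof.ord) : α i ∈ J := hJ.image_eq ▸ ⟨i, hi, rfl⟩
  let P : Bool → Fin l → Set Ordinal.{u} := fun b => bif b then P₀ else P₁
  have hwit (b : Bool) : Witnesses δ (P b) J := by
    cases b
    exacts [hJ.witnesses₁, hJ.witnesses₀]
  obtain ⟨hrec₀, hrec₁⟩ := hJ.recurs hn hWA
  obtain ⟨J', hJ'⟩ := exists_witnesses hδ fun r => shuffle δ.cof.ord α a (P₀ r) (P₁ r)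
  -- Such a γ computes the `ATh` of the shuffle, by J', and is also some α_j, by J.
  obtain ⟨γ, ⟨hγJ, hγJ'⟩, hγ0, hγc⟩ :=
    (hJ.witnesses₀.1.inter hδ hJ'.1).exists_cof_eq_aleph0 hδ hδ0
  have hγJα := hγJ
  rw [← hJ.image_eq] at hγJα
  obtain ⟨j, hj, rfl⟩ := hγJα
  have hj0 : 0 < j := by
    rcases eq_or_ne j 0 with rfl | h
    · exact absurd hγ0 (hJ.zero.trans_le zero_le).not_gt
    · exact pos_iff_ne_zero.2 h
  have key := segTheory_of_piecewise (n := n) (P := P) (s := fun b i => ATh n (α i) δ (P b))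
    (c := fun i => decide (i ∈ a)) (X := fun r => shuffle δ.cof.ord α a (P₀ r) (P₁ r))
    hlim hJ.strictMonoOn (fun j hj hjl => hJ.isLUB_image hj hjl) hJ.cof_succ
    (fun b i j hij hj hjc =>
      ((hwit b).ATh_eq hδ (hmem hj) (hJ.strictMonoOn (hij.trans hj) hj hij) hjc).symm)
    (fun b b' j hj hjc => by
      obtain ⟨k₁, k₂, h₁, h₂⟩ := hrec₀ j hj hjc.le
      obtain ⟨k₁', k₂', h₁', h₂'⟩ := hrec₁ j hj hjc.le
      cases b <;> cases b'
      exacts [⟨k₁', h₁'⟩, ⟨k₂, h₂⟩, ⟨k₂', h₂'⟩, ⟨k₁, h₁⟩])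
    (fun j hj hjc => by
      by_cases hja : j ∈ a
      · obtain ⟨C, hC, hCa⟩ := (ha.2 j hj hjc).1 hja
        exact ⟨C, hC, fun i hi => by simp [hCa hi, hja]⟩
      · obtain ⟨C, hC, hCa⟩ := (ha.2 j hj hjc).2 hja
        have hCn : ∀ i ∈ C, i ∉ a := fun i hi hia =>
          (Set.eq_empty_iff_forall_notMem.1 hCa i) ⟨hi, hia⟩
        exact ⟨C, hC, fun i hi => by simp [hCn i hi, hja]⟩)
    (fun i hi r x hx => by
      rw [mem_shuffle_iff hJ.strictMonoOn ha.1 hi hx]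
      by_cases hia : i ∈ a <;> simp [hia, P])
    j hj hγc 0 hj0
  rw [hJ'.ATh_eq hδ hγJ' hγ0 hγc]
  simp only [hJ.zero] at key
  rw [key]
  -- The theory found is that of P₀ or P₁ at 0, according to whether 0 lies in a; the two coincide.
  by_cases h0 : (0 : Ordinal.{u}) ∈ a <;> simp [h0, P, h01]
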